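/- Let $\mathscr A$ be a Banach $^*$-algebra, that is, a complex (not necessarily unital) $^*$-algebra with a complete submultiplicative norm; the involution is not assumed to be continuous. Let $\mathscr M$ be a left ideal of $\mathscr A$ (a linear subspace with $xa\in\mathscr M$ for all $x\in\mathscr A$, $a\in\mathscr M$; not assumed closed), and let $f:\mathscr M\to\mathbb C$ be a linear functional. A linear functional $g:\mathscr A\to\mathbb C$ is called positive if $g(x^*x)\ge 0$ for all $x\in\mathscr A$; a positive functional $g$ is called representable if there are a Hilbert space $H$, a $^*$-representation $\pi$ of $\mathscr A$ by bounded operators on $H$, and a vector $\zeta\in H$ such that $g(x)=(\pi(x)\zeta\,|\,\zeta)$ for all $x\in\mathscr A$. Let $\mathscr A'$ denote the space of continuous linear functionals on $\mathscr A$. The following statements are equivalent: (i) There is a representable positive functional $f_N\in\mathscr A'$ extending $f$ which is minimal in the sense that $$f_N(x^*x)\le\widetilde f(x^*x)\qquad\text{for all }x\in\mathscr A$$ holds for every representable positive functional $\widetilde f\in\mathscr A'$ extending $f$. (ii) There is a representable positive functional $\widetilde f\in\mathscr A'$ extending $f$. (iii) There is a number $C\ge 0$ such that for all $a\in\mathscr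 M$ the number $C\cdot f(a^*a)$ is real and $$|f(a)|^2\le C\cdot f(a^*a).$$ -/

import Mathlib

open scoped ComplexOrder

universe u

/-- A left ideal of a (possibly non-unital) complex algebra: a linear subspace `M` such that
`x * a ∈ M` whenever `a ∈ M`. -/
def IsLeftIdeal {A : Type u} [NonUnitalNormedRing A] [NormedSpace ℂ A]
    (M : Submodule ℂ A) : Prop :=
  ∀ x : A, ∀ a ∈ M, x * a ∈ M

/-- A linear functional `g` on a `*`-algebra is positive if `g (x* x) ≥ 0` for all `x`
(in the order of `ℂ`: the value is real and nonnegative). -/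
def IsPositiveFunctional {A : Type u} [NonUnitalNormedRing A] [NormedSpace ℂ A] [Star A]
    (g : A →ₗ[ℂ] ℂ) : Prop :=
  ∀ x : A, 0 ≤ g (star x * x)

/-- A positive functional `g` is representable if there are a `*`-representation `π` of `A` by
bounded operators on a Hilbert space `H` and a vector `ζ` with `g x = (π(x)ζ | ζ)` for all `x`.
Mathlib's inner product is linear in the second variable, hence the order of the arguments.
No generality is lost by taking `H` in the universe of `A`, because one may restrict `π` to the
closed linear span of `π(A)ζ` and project `ζ` onto it. -/
def IsRepresentable {A : Type u} [NonUnitalNormedRing A] [NormedSpace ℂ A] [Star A]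
    (g : A →ₗ[ℂ] ℂ) : Prop :=
  IsPositiveFunctional g ∧
    ∃ (H : Type u) (_ : NormedAddCommGroup H) (_ : InnerProductSpace ℂ H) (_ : CompleteSpace H)
      (π : A →⋆ₙₐ[ℂ] (H →L[ℂ] H)) (ζ : H), ∀ x : A, g x = inner ℂ ζ (π x ζ)

/-- `g`, a continuous linear functional on `A`, is a representable positive extension of the
linear functional `f` on the subspace `M`. -/
def IsRepresentableExtension {A : Type u} [NonUnitalNormedRing A] [NormedSpace ℂ A] [Star A]
    {M : Submodule ℂ A} (f : M →ₗ[ℂ] ℂ) (g : A →L[ℂ] ℂ) : Prop :=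
  IsRepresentable (g : A →ₗ[ℂ] ℂ) ∧ ∀ a : M, g (a : A) = f a

/-!
The sesquilinear form `(a, b) ↦ f (a* b)` on the left ideal `M` is a semi-inner product as soon as
the bound (iii) holds, and `A` acts on `M` by left multiplication, `x*` being a formal adjoint of
`x`. A self-adjoint `h` with `‖h‖ < 1` satisfies `1 - h = (1 - y)²` for a self-adjoint `y` (Ford's
square root lemma, where the involution need not be continuous), so `A` acts by bounded operators
and the action passes to a representation `π` on the Hilbert space completion. The bound (iii) and
the Riesz theorem provide a vector `ζ` with `f a = (Λ a | ζ)`, where `Λ a` is the class of `a`;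
then `π(a) ζ = Λ a`, and `f_N x = (π(x) ζ | ζ)` extends `f`. It is continuous because
`*`-homomorphisms of Banach `*`-algebras into C⋆-algebras are. If another extension is given by a
representation `σ` and a vector `ξ`, then `Λ a ↦ σ(a) ξ` is isometric and the adjoint of its
extension is a contraction that intertwines `σ` with `π` and maps `ξ` to `ζ`. Hence
`f_N (x* x) = ‖π(x) ζ‖² ≤ ‖σ(x) ξ‖²`, which is minimality.
-/

open Filter Topology UniformSpace
open scoped NNReal ENNReal InnerProductSpace

section SpectralRadius

theorem spectralRadius_star {𝕜 B : Type*} [NormedField 𝕜] [StarRing 𝕜] [NormedStarGroup 𝕜]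
    [Ring B] [StarRing B] [Algebra 𝕜 B] [StarModule 𝕜 B] (b : B) :
    spectralRadius 𝕜 (star b) = spectralRadius 𝕜 b := by
  simp only [spectralRadius, spectrum.map_star, ← Set.image_star, iSup_image, nnnorm_star]

variable {B : Type*} [NormedRing B] [NormedAlgebra ℂ B] [CompleteSpace B]

theorem exists_norm_pow_le_of_spectralRadius_lt {x : B} {r : ℝ≥0} (hr : spectralRadius ℂ x < r) :
    ∃ K : ℝ, ∀ n : ℕ, ‖x ^ n‖ ≤ K * (r : ℝ) ^ n := by
  have hr0 : r ≠ 0 := by rintro rfl; simp at hr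
  have hev : ∀ᶠ n : ℕ in atTop, ‖x ^ n‖ ≤ ‖(r : ℝ) ^ n‖ := by
    filter_upwards [(spectrum.gelfand_formula x).eventually_lt_const hr, eventually_gt_atTop 0]
      with n hn hn0
    rw [one_div, ENNReal.rpow_inv_lt_iff (by positivity), ENNReal.rpow_natCast] at hn
    have : ‖x ^ n‖₊ ≤ r ^ n := mod_cast hn.le
    simpa using NNReal.coe_le_coe.mpr this
  obtain ⟨K, -, hK⟩ := Asymptotics.bound_of_isBigO_nat_atTop (.of_norm_eventuallyLE hev)
  refine ⟨K, fun n => ?_⟩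
  simpa using hK (x := n) (norm_ne_zero_iff.mpr (pow_ne_zero n (mod_cast hr0)))

theorem le_of_forall_pow_le_mul_pow {R : Type*} [Field R] [LinearOrder R] [IsStrictOrderedRing R]
    [Archimedean R] {a r K : R} (hr : 0 < r)
    (h : ∀ n : ℕ, a ^ n ≤ K * r ^ n) : a ≤ r := by
  by_contra! har
  obtain ⟨n, hn⟩ := pow_unbounded_of_one_lt K ((one_lt_div hr).mpr har)
  rw [div_pow, lt_div_iff₀ (by positivity)] at hn
  exact (h n).not_gt hn

theorem spectralRadius_le_of_norm_pow_le {x : B} {K : ℝ} {r : ℝ≥0} (hr : 0 < r)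
    (h : ∀ n : ℕ, ‖x ^ n‖ ≤ K * (r : ℝ) ^ n) : spectralRadius ℂ x ≤ r := by
  refine iSup₂_le fun k hk => ENNReal.coe_le_coe.mpr ?_
  refine le_of_forall_pow_le_mul_pow (R := ℝ) (K := K * ‖(1 : B)‖) (mod_cast hr) fun n => ?_
  calc ‖k‖ ^ n = ‖k ^ n‖ := (norm_pow k n).symm
    _ ≤ ‖x ^ n‖ * ‖(1 : B)‖ := spectrum.norm_le_norm_mul_of_mem (spectrum.pow_mem_pow x n hk)
    _ ≤ K * (r : ℝ) ^ n * ‖(1 : B)‖ := by gcongr; exact h n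
    _ = K * ‖(1 : B)‖ * (r : ℝ) ^ n := by ring

theorem spectralRadius_add_le_of_commute {x y : B} (hxy : Commute x y) :
    spectralRadius ℂ (x + y) ≤ spectralRadius ℂ x + spectralRadius ℂ y := by
  refine le_of_forall_gt_imp_ge_of_dense fun s hs => ?_
  obtain ⟨p, hp, q, hq, hpq⟩ := ENNReal.exists_add_lt_of_add_lt hs
  lift p to ℝ≥0 using ((le_add_right le_rfl).trans_lt hpq).ne_top
  lift q to ℝ≥0 using ((le_add_left le_rfl).trans_lt hpq).ne_top
  obtain ⟨K, hK⟩ := exists_norm_pow_le_of_spectralRadius_lt hp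
  obtain ⟨L, hL⟩ := exists_norm_pow_le_of_spectralRadius_lt hq
  have hK0 : 0 ≤ K := by simpa using (norm_nonneg _).trans (hK 0)
  have hp0 : 0 < p := ENNReal.coe_pos.mp (bot_le.trans_lt hp)
  refine (spectralRadius_le_of_norm_pow_le (K := K * L) (add_pos_of_pos_of_nonneg hp0 q.2)
    fun n => ?_).trans (by exact_mod_cast hpq.le)
  calc ‖(x + y) ^ n‖
      ≤ ∑ m ∈ Finset.range (n + 1), ‖x ^ m‖ * ‖y ^ (n - m)‖ * n.choose m := by
        rw [hxy.add_pow]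
        refine norm_sum_le_of_le _ fun m _ => ?_
        rw [← nsmul_eq_mul']
        refine (norm_nsmul_le).trans ?_
        rw [mul_comm]
        gcongr
        exact norm_mul_le _ _
    _ ≤ ∑ m ∈ Finset.range (n + 1), K * (p : ℝ) ^ m * (L * (q : ℝ) ^ (n - m)) * n.choose m := by
        gcongr
        · exact hK m
        · exact hL _
    _ = K * L * ((p + q : ℝ≥0) : ℝ) ^ n := by
        push_cast
        rw [add_pow, Finset.mul_sum]
        exact Finset.sum_congr rfl fun m _ => by ring

theorem eq_of_add_self_sub_mul_self_eq {x y : B} (hxy : Commute x y) (hx : spectralRadius ℂ x < 1)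
    (hy : spectralRadius ℂ y < 1) (h : x + x - x * x = y + y - y * y) : x = y := by
  have hr : spectralRadius ℂ (x + y) < ‖(2 : ℂ)‖₊ := by
    calc spectralRadius ℂ (x + y) ≤ spectralRadius ℂ x + spectralRadius ℂ y :=
          spectralRadius_add_le_of_commute hxy
      _ < 1 + 1 := ENNReal.add_lt_add hx hy
      _ = ‖(2 : ℂ)‖₊ := by simp [one_add_one_eq_two]
  have hunit : IsUnit (algebraMap ℂ B 2 - (x + y)) :=
    spectrum.mem_resolventSet_of_spectralRadius_lt hr
  have hzero : (algebraMap ℂ B 2 - (x + y)) * (x - y) = 0 := by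
    calc (algebraMap ℂ B 2 - (x + y)) * (x - y)
        = (x + x - x * x) - (y + y - y * y) + (x * y - y * x) := by
          rw [map_ofNat]; noncomm_ring
      _ = 0 := by rw [h, hxy.eq]; simp
  exact sub_eq_zero.mp (hunit.mul_right_eq_zero.mp hzero)

end SpectralRadius

section SquareRoot

variable {A : Type*} [NonUnitalNormedRing A] [NormedSpace ℂ A] [CompleteSpace A]

theorem exists_add_self_eq_add_mul_self {h : A} (hh : ‖h‖ < 1) :
    ∃ x : A, ‖x‖ ≤ ‖h‖ ∧ x + x = h + x * x := by
  let T : A → A := fun x => (2⁻¹ : ℂ) • (h + x * x)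
  have mapsTo : Set.MapsTo T (Metric.closedBall 0 ‖h‖) (Metric.closedBall 0 ‖h‖) := by
    intro x hx
    rw [mem_closedBall_zero_iff] at hx ⊢
    calc ‖T x‖ = 2⁻¹ * ‖h + x * x‖ := by
          rw [norm_smul, norm_inv, RCLike.norm_ofNat]
      _ ≤ 2⁻¹ * (‖h‖ + ‖h‖ * ‖h‖) := by
        gcongr
        exact (norm_add_le _ _).trans (by gcongr; exact (norm_mul_le _ _).trans (by gcongr))
      _ ≤ ‖h‖ := by nlinarith [norm_nonneg h]
  have contracting : ContractingWith ‖h‖₊ (mapsTo.restrict T _ _) := by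
    refine ⟨hh, LipschitzWith.of_dist_le_mul fun ⟨x, hx⟩ ⟨y, hy⟩ => ?_⟩
    rw [mem_closedBall_zero_iff] at hx hy
    rw [Subtype.dist_eq, Subtype.dist_eq, dist_eq_norm, dist_eq_norm]
    calc ‖T x - T y‖ = ‖(2⁻¹ : ℂ) • (x * (x - y) + (x - y) * y)‖ := by
          rw [← smul_sub]; congr 2; noncomm_ring
      _ ≤ 2⁻¹ * (‖h‖ * ‖x - y‖ + ‖x - y‖ * ‖h‖) := by
          rw [norm_smul, norm_inv, RCLike.norm_ofNat]
          gcongr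
          refine (norm_add_le _ _).trans (add_le_add ?_ ?_) <;>
            exact (norm_mul_le _ _).trans (by gcongr)
      _ = ‖h‖ * ‖x - y‖ := by ring
  obtain ⟨x, hx, hfix, -⟩ := contracting.exists_fixedPoint' Metric.isClosed_closedBall.isComplete
    mapsTo (x := 0) (by simp) (edist_ne_top _ _)
  refine ⟨x, mem_closedBall_zero_iff.mp hx, ?_⟩
  calc x + x = (2 : ℂ) • T x := by rw [hfix.eq, two_smul]
    _ = h + x * x := smul_inv_smul₀ two_ne_zero _

variable [IsScalarTower ℂ A A] [SMulCommClass ℂ A A]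

theorem spectralRadius_inr_le (x : A) : spectralRadius ℂ (x : Unitization ℂ A) ≤ ‖x‖₊ := by
  refine iSup₂_le fun k hk => ENNReal.coe_le_coe.mpr ?_
  rw [← AlgEquiv.spectrum_eq (WithLp.unitizationAlgEquiv (𝕜 := ℂ) (A := A) ℂ).symm] at hk
  have hone : ‖(1 : WithLp 1 (Unitization ℂ A))‖ = 1 := by
    rw [WithLp.unitization_norm_def]
    simp [show (1 : WithLp 1 (Unitization ℂ A)).ofLp = 1 from rfl]
  calc ‖k‖ ≤ ‖(WithLp.unitizationAlgEquiv ℂ).symm (x : Unitization ℂ A)‖ := by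
        simpa only [hone, mul_one] using spectrum.norm_le_norm_mul_of_mem hk
    _ = ‖x‖ := WithLp.unitization_norm_inr x

theorem exists_add_self_eq_add_mul_self_of_commute {h : A} (hh : ‖h‖ < 1) :
    ∃ x : A, ‖x‖ ≤ ‖h‖ ∧ x + x = h + x * x ∧ ∀ y, Commute y h → Commute y x := by
  let : NormedSpace ℂ (NonUnitalAlgebra.elemental ℂ h) :=
    Submodule.normedSpace (NonUnitalAlgebra.elemental ℂ h).toSubmodule
  let h' : NonUnitalAlgebra.elemental ℂ h := ⟨h, NonUnitalAlgebra.elemental.self_mem ℂ h⟩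
  obtain ⟨x, hx, hxh⟩ := exists_add_self_eq_add_mul_self (h := h') hh
  refine ⟨x, hx, congrArg Subtype.val hxh, fun y hy => ?_⟩
  have := NonUnitalAlgebra.elemental.le_centralizer_centralizer ℂ h x.2
  exact this y (by rintro _ rfl; exact hy.eq.symm)

theorem exists_isSelfAdjoint_add_self_eq_add_mul_self [StarRing A] [StarModule ℂ A] {h : A}
    (hh : ‖h‖ < 1) (hsa : IsSelfAdjoint h) :
    ∃ x : A, IsSelfAdjoint x ∧ x + x = h + x * x := by
  obtain ⟨x, hx, hxh, hcomm⟩ := exists_add_self_eq_add_mul_self_of_commute hh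
  refine ⟨x, ?_, hxh⟩
  have hstar : star x + star x = h + star x * star x := by
    simpa [hsa.star_eq] using congrArg star hxh
  have hxx : Commute (star x) x := by
    refine hcomm _ ?_
    rw [← add_sub_cancel_right h (star x * star x), ← hstar]
    exact ((Commute.refl _).add_right (.refl _)).sub_right ((Commute.refl _).mul_right (.refl _))
  have hr : spectralRadius ℂ (x : Unitization ℂ A) < 1 :=
    (spectralRadius_inr_le x).trans_lt (mod_cast hx.trans_lt hh)
  have hr' : spectralRadius ℂ ((star x : A) : Unitization ℂ A) < 1 := by
    rwa [Unitization.inr_star, spectralRadius_star]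
  let e := (WithLp.unitizationAlgEquiv (𝕜 := ℂ) (A := A) ℂ).symm
  have radius (z : Unitization ℂ A) : spectralRadius ℂ (e z) = spectralRadius ℂ z := by
    simp only [spectralRadius, AlgEquiv.spectrum_eq]
  have huniq : e (star x : A) = e x := by
    refine eq_of_add_self_sub_mul_self_eq ?_ (by rwa [radius]) (by rwa [radius]) ?_
    · exact (hxx.map (Unitization.inrNonUnitalAlgHom ℂ A)).map e
    · simp only [← map_add, ← map_mul, ← map_sub, ← Unitization.inr_add, ← Unitization.inr_mul,
        ← Unitization.inr_sub, hxh, hstar, add_sub_cancel_right]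
  exact Unitization.inr_injective (e.injective huniq)

end SquareRoot

section StarRepresentation

variable {A E : Type*} [SeminormedAddCommGroup E] [InnerProductSpace ℂ E]

/-- The `*`-representations of an algebra by not necessarily bounded operators on a space with a
possibly degenerate inner product; `star x` acts as a formal adjoint of `x`. -/
def IsStarRepresentation [NonUnitalNonAssocSemiring A] [Module ℂ A] [Star A]
    (ρ : A →ₙₐ[ℂ] Module.End ℂ E) : Prop :=
  ∀ x a b, ⟪ρ x a, b⟫_ℂ = ⟪a, ρ (star x) b⟫_ℂ

theorem IsStarRepresentation.norm_apply_sq [NonUnitalNonAssocSemiring A] [Module ℂ A] [Star A]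
    {ρ : A →ₙₐ[ℂ] Module.End ℂ E} (hρ : IsStarRepresentation ρ) (x : A) (a : E) :
    ‖ρ x a‖ ^ 2 = (⟪a, ρ (star x * x) a⟫_ℂ).re := by
  rw [← inner_self_eq_norm_sq (𝕜 := ℂ), hρ, map_mul]
  rfl

theorem completion_clm_ext {S T : Completion E →L[ℂ] Completion E}
    (h : ∀ a : E, S a = T a) : S = T :=
  DFunLike.coe_injective (Completion.ext S.continuous T.continuous h)

namespace IsStarRepresentation

variable [NonUnitalNormedRing A] [NormedSpace ℂ A] [IsScalarTower ℂ A A] [SMulCommClass ℂ A A]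
  [CompleteSpace A] [StarRing A] [StarModule ℂ A]
  {ρ : A →ₙₐ[ℂ] Module.End ℂ E} (hρ : IsStarRepresentation ρ)
include hρ

theorem re_inner_apply_le {h : A} (hh : ‖h‖ < 1) (hsa : IsSelfAdjoint h) (a : E) :
    (⟪a, ρ h a⟫_ℂ).re ≤ ‖a‖ ^ 2 := by
  obtain ⟨y, hy, hyh⟩ := exists_isSelfAdjoint_add_self_eq_add_mul_self hh hsa
  -- Since `1 - h = (1 - y)²`, the difference of the two sides is `‖a - ρ y a‖ ^ 2`.
  have hsq : ‖a - ρ y a‖ ^ 2 = ‖a‖ ^ 2 - (⟪a, ρ h a⟫_ℂ).re := by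
    rw [norm_sub_sq (𝕜 := ℂ), hρ.norm_apply_sq, hy.star_eq, ← sub_eq_iff_eq_add.mpr hyh]
    simp only [map_sub, map_add, LinearMap.sub_apply, LinearMap.add_apply, inner_sub_right,
      inner_add_right, Complex.sub_re, Complex.add_re, RCLike.re_to_complex]
    ring
  linarith [sq_nonneg ‖a - ρ y a‖]

theorem norm_apply_sq_le (x : A) (a : E) : ‖ρ x a‖ ^ 2 ≤ ‖star x * x‖ * ‖a‖ ^ 2 := by
  have scaled {c : ℝ} (hc : ‖star x * x‖ < c) : ‖ρ x a‖ ^ 2 ≤ c * ‖a‖ ^ 2 := by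
    have hc0 : 0 < c := (norm_nonneg _).trans_lt hc
    have hnorm : ‖((c⁻¹ : ℝ) : ℂ) • (star x * x)‖ < 1 := by
      rw [norm_smul, Complex.norm_of_nonneg (by positivity)]
      exact (inv_mul_lt_one₀ hc0).mpr hc
    have := hρ.re_inner_apply_le hnorm
      (IsSelfAdjoint.smul (Complex.conj_ofReal _) (.star_mul_self x)) a
    rwa [map_smul, LinearMap.smul_apply, inner_smul_right, Complex.re_ofReal_mul,
      ← hρ.norm_apply_sq, inv_mul_le_iff₀ hc0] at this
  refine le_mul_of_forall_lt₀ fun c hc b hb => (scaled hc).trans ?_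
  exact mul_le_mul_of_nonneg_left hb.le ((norm_nonneg _).trans hc.le)

/-- The bounded operator by which `x` acts. -/
noncomputable def boundedOperator (x : A) : E →L[ℂ] E :=
  (ρ x).mkContinuous √‖star x * x‖ fun a => by
    refine le_of_sq_le_sq ?_ (by positivity)
    rw [mul_pow, Real.sq_sqrt (by positivity)]
    exact hρ.norm_apply_sq_le x a

theorem completion_boundedOperator_coe (x : A) (a : E) :
    (hρ.boundedOperator x).completion (a : Completion E) = (ρ x a : E) :=
  (hρ.boundedOperator x).completion_apply_coe a

/-- The `*`-representation by bounded operators on the Hilbert space completion that extends a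
`*`-representation of a Banach `*`-algebra. -/
noncomputable def completion : A →⋆ₙₐ[ℂ] (Completion E →L[ℂ] Completion E) where
  toFun x := (hρ.boundedOperator x).completion
  map_smul' r x := completion_clm_ext fun a => by
    simp only [smul_apply, completion_boundedOperator_coe, map_smul, LinearMap.smul_apply,
      Completion.coe_smul, MonoidHom.id_apply]
  map_zero' := completion_clm_ext fun a => by
    simp only [completion_boundedOperator_coe, map_zero, LinearMap.zero_apply, Completion.coe_zero,
      zero_apply]
  map_add' x y := completion_clm_ext fun a => by
    simp only [add_apply, completion_boundedOperator_coe, map_add, LinearMap.add_apply,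
      Completion.coe_add]
  map_mul' x y := completion_clm_ext fun a => by
    simp only [mul_apply_eq_comp, completion_boundedOperator_coe, map_mul, Module.End.mul_apply]
  map_star' x := by
    refine (ContinuousLinearMap.eq_adjoint_iff _ _).mpr fun a b => ?_
    induction a, b using Completion.induction_on₂ with
    | hp => exact isClosed_eq (by fun_prop) (by fun_prop)
    | ih a b => rw [completion_boundedOperator_coe, completion_boundedOperator_coe,
        Completion.inner_coe, Completion.inner_coe, hρ, star_star]

end IsStarRepresentation

end StarRepresentation

section AutomaticContinuity

variable {A B : Type*} [NonUnitalNormedRing A] [NormedSpace ℂ A]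
  [IsScalarTower ℂ A A] [SMulCommClass ℂ A A] [CompleteSpace A] [NonUnitalCStarAlgebra B]

variable {F : Type*} [FunLike F A B] [NonUnitalAlgHomClass F ℂ A B]

theorem norm_map_le_of_isSelfAdjoint (φ : F) {x : A} (hx : IsSelfAdjoint (φ x)) :
    ‖φ x‖ ≤ ‖x‖ := by
  have hspec : spectrum ℂ (φ x : Unitization ℂ B) ⊆ spectrum ℂ (x : Unitization ℂ A) := by
    simpa only [Unitization.quasispectrum_eq_spectrum_inr]
      using NonUnitalAlgHom.quasispectrum_apply_subset φ x
  have : (‖φ x‖₊ : ℝ≥0∞) ≤ ‖x‖₊ :=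
    calc (‖φ x‖₊ : ℝ≥0∞) = ‖(φ x : Unitization ℂ B)‖₊ := by rw [Unitization.nnnorm_inr]
      _ = spectralRadius ℂ (φ x : Unitization ℂ B) :=
        ((hx.inr ℂ).spectralRadius_eq_nnnorm).symm
      _ ≤ spectralRadius ℂ (x : Unitization ℂ A) := biSup_mono hspec
      _ ≤ ‖x‖₊ := spectralRadius_inr_le x
  exact_mod_cast this

theorem norm_map_sq_le_of_map_eq_star (φ : F) {x y : A} (h : φ y = star (φ x)) :
    ‖φ x‖ ^ 2 ≤ ‖y‖ * ‖x‖ := by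
  have hyx : φ (y * x) = star (φ x) * φ x := by rw [map_mul, h]
  calc ‖φ x‖ ^ 2 = ‖φ (y * x)‖ := by rw [hyx, CStarRing.norm_star_mul_self, sq]
    _ ≤ ‖y * x‖ := norm_map_le_of_isSelfAdjoint φ (by rw [hyx]; exact .star_mul_self _)
    _ ≤ ‖y‖ * ‖x‖ := norm_mul_le y x

variable [StarRing A]

theorem tendsto_map_of_map_eq_star (φ : A →⋆ₙₐ[ℂ] B) {u v : ℕ → A} {x y : A}
    (huv : ∀ n, φ (v n) = star (φ (u n))) (hu : Tendsto u atTop (𝓝 x))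
    (hv : Tendsto v atTop (𝓝 y)) : Tendsto (fun n => φ (u n)) atTop (𝓝 (φ x)) := by
  have hbound (n : ℕ) : ‖φ (u n) - φ x‖ ^ 2 ≤ ‖v n - star x‖ * ‖u n - x‖ := by
    rw [← map_sub]
    exact norm_map_sq_le_of_map_eq_star φ (by simp only [map_sub, map_star, star_sub, huv])
  have hprod : Tendsto (fun n => ‖v n - star x‖ * ‖u n - x‖) atTop (𝓝 0) := by
    simpa using (hv.sub_const (star x)).norm.mul (hu.sub_const x).norm
  have hsq : Tendsto (fun n => ‖φ (u n) - φ x‖ ^ 2) atTop (𝓝 0) :=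
    squeeze_zero (fun _ => by positivity) hbound hprod
  rw [tendsto_iff_norm_sub_tendsto_zero]
  simpa using hsq.sqrt

/-- The real subspace of pairs `(x, y)` for which `y` cannot be told apart from `star x` by `φ`.
Unlike the graph of a discontinuous involution it is closed. -/
def starPairs (φ : A →⋆ₙₐ[ℂ] B) : Submodule ℝ (A × A) where
  carrier := {p | φ p.2 = star (φ p.1)}
  zero_mem' := by simp
  add_mem' := fun {p q} hp hq => by simp_all
  smul_mem' r p hp := by
    change φ p.2 = star (φ p.1) at hp
    change φ (r • p.2) = star (φ (r • p.1))
    rw [← Complex.coe_smul, ← Complex.coe_smul, map_smul, map_smul, star_smul, hp]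
    simp

theorem isClosed_starPairs (φ : A →⋆ₙₐ[ℂ] B) : IsClosed (starPairs φ : Set (A × A)) := by
  refine IsSeqClosed.isClosed fun p q hp hpq => ?_
  have hfst : Tendsto (fun n => (p n).1) atTop (𝓝 q.1) := (continuous_fst.tendsto q).comp hpq
  have hsnd : Tendsto (fun n => (p n).2) atTop (𝓝 q.2) := (continuous_snd.tendsto q).comp hpq
  have pair (n : ℕ) : φ (p n).2 = star (φ (p n).1) := hp n
  have hlim := (tendsto_map_of_map_eq_star φ pair hfst hsnd).star
  simp only [← pair] at hlim
  have hlim' := tendsto_map_of_map_eq_star φ (fun n => by rw [pair, star_star]) hsnd hfst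
  exact tendsto_nhds_unique hlim' hlim

theorem exists_norm_map_le (φ : A →⋆ₙₐ[ℂ] B) : ∃ C : ℝ, ∀ x, ‖φ x‖ ≤ C * ‖x‖ := by
  have : CompleteSpace (starPairs φ) := (isClosed_starPairs φ).completeSpace_coe
  let fst : starPairs φ →L[ℝ] A := (ContinuousLinearMap.fst ℝ A A).comp (starPairs φ).subtypeL
  have hfst : Function.Surjective fst := fun x => ⟨⟨(x, star x), map_star φ x⟩, rfl⟩
  obtain ⟨C, hC, h⟩ := fst.exists_preimage_norm_le hfst
  refine ⟨√C, fun x => ?_⟩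
  obtain ⟨⟨⟨x, y⟩, hxy⟩, rfl, hp⟩ := h x
  have hy : ‖y‖ ≤ C * ‖x‖ := (norm_snd_le (x, y)).trans hp
  refine le_of_sq_le_sq ?_ (by positivity)
  calc ‖φ x‖ ^ 2 ≤ ‖y‖ * ‖x‖ := norm_map_sq_le_of_map_eq_star φ hxy
    _ ≤ C * ‖x‖ * ‖x‖ := by gcongr
    _ = (√C * ‖x‖) ^ 2 := by rw [mul_pow, Real.sq_sqrt hC.le]; ring

end AutomaticContinuity

section InnerProduct

variable {A : Type*} [NonUnitalNonAssocSemiring A] [Module ℂ A] [Star A]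
  {H : Type*} [NormedAddCommGroup H] [InnerProductSpace ℂ H] [CompleteSpace H]
  (π : A →⋆ₙₐ[ℂ] (H →L[ℂ] H))

theorem inner_map_left (x : A) (u v : H) : ⟪π x u, v⟫_ℂ = ⟪u, π (star x) v⟫_ℂ := by
  rw [map_star, ContinuousLinearMap.star_eq_adjoint, ContinuousLinearMap.adjoint_inner_right]

theorem inner_map_star_mul (ζ : H) (x y : A) : ⟪ζ, π (star x * y) ζ⟫_ℂ = ⟪π x ζ, π y ζ⟫_ℂ := by
  rw [inner_map_left, map_mul, mul_apply_eq_comp]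

theorem inner_map_star_mul_self (ζ : H) (x : A) :
    ⟪ζ, π (star x * x) ζ⟫_ℂ = ((‖π x ζ‖ ^ 2 : ℝ) : ℂ) := by
  rw [inner_map_star_mul, inner_self_eq_norm_sq_to_K, Complex.ofReal_pow]
  rfl

end InnerProduct

section VectorFunctional

variable {A : Type u} [NonUnitalNormedRing A] [NormedSpace ℂ A] [IsScalarTower ℂ A A]
  [SMulCommClass ℂ A A] [CompleteSpace A] [StarRing A]
  {H : Type u} [NormedAddCommGroup H] [InnerProductSpace ℂ H] [CompleteSpace H]
  (π : A →⋆ₙₐ[ℂ] (H →L[ℂ] H)) (ζ : H)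

/-- The functional `x ↦ (π(x)ζ | ζ)` defined by a representation and a vector. -/
noncomputable def vectorFunctional : A →L[ℂ] ℂ :=
  (innerSL ℂ ζ ∘L ContinuousLinearMap.apply ℂ H ζ) ∘L
    LinearMap.mkContinuousOfExistsBound
      ((π : A →ₙₐ[ℂ] (H →L[ℂ] H)) : A →ₗ[ℂ] (H →L[ℂ] H)) (exists_norm_map_le π)

theorem vectorFunctional_apply (x : A) : vectorFunctional π ζ x = ⟪ζ, π x ζ⟫_ℂ := rfl

theorem isRepresentable_vectorFunctional :
    IsRepresentable (vectorFunctional π ζ : A →ₗ[ℂ] ℂ) := by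
  refine ⟨fun x => ?_, H, ‹_›, ‹_›, ‹_›, π, ζ, vectorFunctional_apply π ζ⟩
  rw [ContinuousLinearMap.coe_coe, vectorFunctional_apply, inner_map_star_mul_self]
  exact Complex.zero_le_real.mpr (sq_nonneg _)

end VectorFunctional

section GNS

theorem exists_inner_eq_of_norm_le {𝕜 E H : Type*} [RCLike 𝕜] [AddCommGroup E] [Module 𝕜 E]
    [NormedAddCommGroup H] [InnerProductSpace 𝕜 H] [CompleteSpace H] {Λ : E →ₗ[𝕜] H}
    (hΛ : DenseRange Λ) {f : E →ₗ[𝕜] 𝕜} {C : ℝ} (hf : ∀ a, ‖f a‖ ≤ C * ‖Λ a‖) :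
    ∃ ζ : H, ∀ a, ⟪ζ, Λ a⟫_𝕜 = f a := by
  refine ⟨(InnerProductSpace.toDual 𝕜 H).symm (f.extendOfNorm Λ), fun a => ?_⟩
  rw [InnerProductSpace.toDual_symm_apply, LinearMap.extendOfNorm_eq hΛ ⟨C, hf⟩]

theorem isPosSemidef_of_isNonneg {E : Type*} [AddCommGroup E] [Module ℂ E]
    {B : E →ₗ⋆[ℂ] E →ₗ[ℂ] ℂ} (hB : B.IsNonneg) : B.IsPosSemidef := by
  have expand (a b : E) (r : ℂ) : B (a + r • b) (a + r • b) =
      B a a + r * B a b + (starRingEnd ℂ r * B b a + starRingEnd ℂ r * r * B b b) := by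
    simp [mul_assoc]
    ring
  have im (a : E) : (B a a).im = 0 := (Complex.nonneg_iff.mp (hB.nonneg a)).2.symm
  refine ⟨⟨fun a b => ?_⟩, hB⟩
  have him : (B a b).im + (B b a).im = 0 := by
    simpa [expand, im a, im b] using im (a + (1 : ℂ) • b)
  have hre : (B a b).re - (B b a).re = 0 := by
    simpa [expand, im a, im b, sub_eq_add_neg] using im (a + Complex.I • b)
  exact Complex.ext (by simpa using by linarith) (by simpa using by linarith)

/-- The semi-inner product given by a positive semidefinite sesquilinear form. -/
abbrev semiInnerProductCore {E : Type*} [AddCommGroup E] [Module ℂ E] {B : E →ₗ⋆[ℂ] E →ₗ[ℂ] ℂ}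
    (hB : B.IsPosSemidef) : PreInnerProductSpace.Core ℂ E where
  inner a b := B a b
  conj_inner_symm a b := hB.isSymm.eq b a
  re_inner_nonneg a := (Complex.nonneg_iff.mp (hB.isNonneg.nonneg a)).1
  add_left := B.map_add₂
  smul_left a b r := B.map_smulₛₗ₂ r a b

/-- A representation of `A` on a Hilbert space that the Gelfand–Naimark–Segal construction produces
from a sesquilinear form `B` on a module `E` on which `A` acts by `ρ`; `Λ` maps a vector of `E` to
its class. -/
structure IsGNSRepresentation {A E H : Type*} [NonUnitalNonAssocSemiring A] [Module ℂ A] [Star A]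
    [AddCommGroup E] [Module ℂ E] [NormedAddCommGroup H] [InnerProductSpace ℂ H] [CompleteSpace H]
    (B : E →ₗ⋆[ℂ] E →ₗ[ℂ] ℂ) (ρ : A →ₙₐ[ℂ] Module.End ℂ E) (π : A →⋆ₙₐ[ℂ] (H →L[ℂ] H))
    (Λ : E →ₗ[ℂ] H) : Prop where
  denseRange : DenseRange Λ
  inner_map (a b : E) : ⟪Λ a, Λ b⟫_ℂ = B a b
  map_apply (x : A) (a : E) : Λ (ρ x a) = π x (Λ a)

theorem exists_isGNSRepresentation {A : Type*} [NonUnitalNormedRing A] [NormedSpace ℂ A]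
    [IsScalarTower ℂ A A] [SMulCommClass ℂ A A] [CompleteSpace A] [StarRing A] [StarModule ℂ A]
    {E : Type u} [AddCommGroup E] [Module ℂ E] {B : E →ₗ⋆[ℂ] E →ₗ[ℂ] ℂ} (hB : B.IsNonneg)
    {ρ : A →ₙₐ[ℂ] Module.End ℂ E} (hρ : ∀ x a b, B (ρ x a) b = B a (ρ (star x) b)) :
    ∃ (H : Type u) (_ : NormedAddCommGroup H) (_ : InnerProductSpace ℂ H) (_ : CompleteSpace H)
      (π : A →⋆ₙₐ[ℂ] (H →L[ℂ] H)) (Λ : E →ₗ[ℂ] H), IsGNSRepresentation B ρ π Λ := by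
  let core := semiInnerProductCore (isPosSemidef_of_isNonneg hB)
  let : SeminormedAddCommGroup E := InnerProductSpace.Core.toSeminormedAddCommGroup (c := core)
  let : InnerProductSpace ℂ E := .ofCore core
  have hstar : IsStarRepresentation ρ := hρ
  exact ⟨Completion E, inferInstance, inferInstance, inferInstance, hstar.completion,
    (Completion.toComplL : E →L[ℂ] Completion E),
    { denseRange := Completion.denseRange_coe
      inner_map := Completion.inner_coe
      map_apply := fun x a => (hstar.completion_boundedOperator_coe x a).symm }⟩

namespace IsGNSRepresentation

variable {A E H : Type*} [NonUnitalNonAssocSemiring A] [Module ℂ A] [Star A]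
  [AddCommGroup E] [Module ℂ E] [NormedAddCommGroup H] [InnerProductSpace ℂ H] [CompleteSpace H]
  {B : E →ₗ⋆[ℂ] E →ₗ[ℂ] ℂ} {ρ : A →ₙₐ[ℂ] Module.End ℂ E} {π : A →⋆ₙₐ[ℂ] (H →L[ℂ] H)}
  {Λ : E →ₗ[ℂ] H} (h : IsGNSRepresentation B ρ π Λ)
include h

theorem ofReal_norm_sq (a : E) : ((‖Λ a‖ ^ 2 : ℝ) : ℂ) = B a a := by
  rw [← h.inner_map, inner_self_eq_norm_sq_to_K, Complex.ofReal_pow]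
  rfl

theorem exists_contraction_intertwining {K : Type*} [NormedAddCommGroup K] [InnerProductSpace ℂ K]
    [CompleteSpace K] (σ : A →⋆ₙₐ[ℂ] (K →L[ℂ] K)) {T : E →ₗ[ℂ] K} (hT : ∀ a, ‖T a‖ ≤ ‖Λ a‖)
    (hTσ : ∀ x a, T (ρ x a) = σ x (T a)) :
    ∃ S : K →L[ℂ] H, ‖S‖ ≤ 1 ∧ (∀ k a, ⟪S k, Λ a⟫_ℂ = ⟪k, T a⟫_ℂ) ∧
      ∀ x k, S (σ x k) = π x (S k) := by
  have hbound (a : E) : ‖T a‖ ≤ 1 * ‖Λ a‖ := by simpa using hT a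
  let S := ContinuousLinearMap.adjoint (T.extendOfNorm Λ)
  have hS (k : K) (a : E) : ⟪S k, Λ a⟫_ℂ = ⟪k, T a⟫_ℂ := by
    rw [ContinuousLinearMap.adjoint_inner_left, LinearMap.extendOfNorm_eq h.denseRange ⟨1, hbound⟩]
  refine ⟨S, ?_, hS, fun x k => h.denseRange.eq_of_inner_left (𝕜 := ℂ) ?_⟩
  · rw [LinearIsometryEquiv.norm_map]
    exact LinearMap.opNorm_extendOfNorm_le h.denseRange zero_le_one hbound
  · intro a
    rw [hS, inner_map_left, ← hTσ, ← hS, h.map_apply, ← inner_map_left]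

end IsGNSRepresentation

end GNS

section LeftIdeal

variable {A : Type u} [NonUnitalNormedRing A] [NormedSpace ℂ A] {M : Submodule ℂ A}

theorem IsRepresentableExtension.exists_bound [StarRing A] (hM : IsLeftIdeal M) {f : M →ₗ[ℂ] ℂ}
    {g : A →L[ℂ] ℂ} (hg : IsRepresentableExtension f g) :
    ∃ C : ℝ, 0 ≤ C ∧ ∀ a : M,
      ((‖f a‖ ^ 2 : ℝ) : ℂ) ≤ (C : ℂ) * f ⟨star (a : A) * a, hM _ _ a.2⟩ := by
  obtain ⟨⟨-, H, _, _, _, π, ζ, hπ⟩, hgf⟩ := hg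
  simp only [ContinuousLinearMap.coe_coe] at hπ
  refine ⟨‖ζ‖ ^ 2, by positivity, fun a => ?_⟩
  rw [← hgf, ← hgf, hπ, hπ, inner_map_star_mul_self]
  norm_cast
  calc ‖⟪ζ, π a ζ⟫_ℂ‖ ^ 2 ≤ (‖ζ‖ * ‖π a ζ‖) ^ 2 := by
        gcongr
        exact norm_inner_le_norm _ _
    _ = ‖ζ‖ ^ 2 * ‖π a ζ‖ ^ 2 := mul_pow _ _ _

namespace IsLeftIdeal

variable [IsScalarTower ℂ A A] [SMulCommClass ℂ A A] (hM : IsLeftIdeal M)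

/-- The representation of an algebra on a left ideal by multiplication on the left. -/
def leftMul : A →ₙₐ[ℂ] Module.End ℂ M where
  toFun x := (LinearMap.mulLeft ℂ x).restrict (hM x)
  map_smul' r x := LinearMap.ext fun a => Subtype.ext (smul_mul_assoc r x (a : A))
  map_zero' := LinearMap.ext fun a => Subtype.ext (zero_mul (a : A))
  map_add' x y := LinearMap.ext fun a => Subtype.ext (add_mul x y (a : A))
  map_mul' x y := LinearMap.ext fun a => Subtype.ext (mul_assoc x y (a : A))

@[simp]
theorem coe_leftMul (x : A) (a : M) : (hM.leftMul x a : A) = x * a := rfl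

variable [StarRing A] [StarModule ℂ A] (f : M →ₗ[ℂ] ℂ)

/-- The sesquilinear form `(a, b) ↦ f (star a * b)` defined by a functional on a left ideal. -/
def form : M →ₗ⋆[ℂ] M →ₗ[ℂ] ℂ :=
  LinearMap.mk₂'ₛₗ (starRingEnd ℂ) (RingHom.id ℂ) (fun a b => f (hM.leftMul (star (a : A)) b))
    (fun a b c => by simp) (fun r a b => by simp) (fun a b c => by simp) (fun r a b => by simp)

theorem form_apply (a b : M) : hM.form f a b = f (hM.leftMul (star (a : A)) b) := rfl

theorem form_leftMul (x : A) (a b : M) :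
    hM.form f (hM.leftMul x a) b = hM.form f a (hM.leftMul (star x) b) := by
  rw [form_apply, form_apply, coe_leftMul, star_mul, map_mul, Module.End.mul_apply]

variable {hM f}

theorem isNonneg_form_of_norm_sq_le {C : ℝ} (hC0 : 0 ≤ C)
    (hC : ∀ a : M, ((‖f a‖ ^ 2 : ℝ) : ℂ) ≤ C * hM.form f a a) : (hM.form f).IsNonneg := by
  refine ⟨fun a => ?_⟩
  rcases hC0.eq_or_lt with rfl | hpos
  · have hf0 (b : M) : f b = 0 := by
      have hb := hC b
      rw [Complex.ofReal_zero, zero_mul, ← Complex.ofReal_zero, Complex.real_le_real] at hb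
      simpa using hb.antisymm (sq_nonneg _)
    rw [form_apply, hf0]
  · have hmul : 0 ≤ C * hM.form f a a := (Complex.zero_le_real.mpr (sq_nonneg ‖f a‖)).trans (hC a)
    simpa [hpos.ne'] using mul_nonneg (Complex.zero_le_real.mpr (inv_nonneg.mpr hC0)) hmul

variable {H : Type u} [NormedAddCommGroup H] [InnerProductSpace ℂ H] [CompleteSpace H]
  {π : A →⋆ₙₐ[ℂ] (H →L[ℂ] H)} {Λ : M →ₗ[ℂ] H}

theorem exists_inner_eq_of_norm_sq_le (h : IsGNSRepresentation (hM.form f) hM.leftMul π Λ) {C : ℝ}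
    (hC : ∀ a : M, ((‖f a‖ ^ 2 : ℝ) : ℂ) ≤ C * hM.form f a a) : ∃ ζ : H, ∀ a, ⟪ζ, Λ a⟫_ℂ = f a := by
  refine exists_inner_eq_of_norm_le (C := √C) h.denseRange fun a => ?_
  have hsq : ‖f a‖ ^ 2 ≤ C * ‖Λ a‖ ^ 2 := by
    have ha := hC a
    rw [← h.ofReal_norm_sq] at ha
    exact_mod_cast ha
  simpa only [Real.sqrt_sq (norm_nonneg _), Real.sqrt_mul' C (sq_nonneg _)] using
    Real.sqrt_le_sqrt hsq

theorem map_apply_eq (h : IsGNSRepresentation (hM.form f) hM.leftMul π Λ) {ζ : H}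
    (hζ : ∀ a, ⟪ζ, Λ a⟫_ℂ = f a) (a : M) : π a ζ = Λ a := by
  refine h.denseRange.eq_of_inner_left (𝕜 := ℂ) fun b => ?_
  rw [inner_map_left, ← h.map_apply, hζ, h.inner_map, form_apply]

theorem norm_map_apply_le (h : IsGNSRepresentation (hM.form f) hM.leftMul π Λ) {ζ : H}
    (hζ : ∀ a, ⟪ζ, Λ a⟫_ℂ = f a) {K : Type*} [NormedAddCommGroup K] [InnerProductSpace ℂ K]
    [CompleteSpace K] {σ : A →⋆ₙₐ[ℂ] (K →L[ℂ] K)} {ξ : K}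
    (hσ : ∀ a : M, ⟪ξ, σ a ξ⟫_ℂ = f a) (x : A) : ‖π x ζ‖ ≤ ‖σ x ξ‖ := by
  let T : M →ₗ[ℂ] K :=
    (ContinuousLinearMap.apply ℂ K ξ : (K →L[ℂ] K) →ₗ[ℂ] K) ∘ₗ
      ((σ : A →ₙₐ[ℂ] (K →L[ℂ] K)) : A →ₗ[ℂ] (K →L[ℂ] K)) ∘ₗ M.subtype
  have hT (a : M) : ‖T a‖ = ‖Λ a‖ := by
    have : ((‖T a‖ ^ 2 : ℝ) : ℂ) = ((‖Λ a‖ ^ 2 : ℝ) : ℂ) := by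
      rw [h.ofReal_norm_sq, form_apply, ← hσ]
      exact (inner_map_star_mul_self σ ξ (a : A)).symm
    exact (sq_eq_sq₀ (norm_nonneg _) (norm_nonneg _)).mp (mod_cast this)
  obtain ⟨S, hS, hinner, hinter⟩ := h.exists_contraction_intertwining σ (fun a => (hT a).le)
    (fun x a => DFunLike.congr_fun (map_mul σ x (a : A)) ξ)
  have hSξ : S ξ = ζ := h.denseRange.eq_of_inner_left (𝕜 := ℂ) fun a => by
    rw [hinner, hζ, ← hσ]
    rfl
  calc ‖π x ζ‖ = ‖S (σ x ξ)‖ := by rw [hinter, hSξ]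
    _ ≤ ‖σ x ξ‖ := S.le_of_opNorm_le_of_le hS le_rfl |>.trans (one_mul _).le

theorem exists_minimal_isRepresentableExtension [CompleteSpace A] (hM : IsLeftIdeal M) {C : ℝ}
    (hC0 : 0 ≤ C) (hC : ∀ a : M, ((‖f a‖ ^ 2 : ℝ) : ℂ) ≤ C * hM.form f a a) :
    ∃ fN : A →L[ℂ] ℂ, IsRepresentableExtension f fN ∧
      ∀ g : A →L[ℂ] ℂ, IsRepresentableExtension f g →
        ∀ x : A, fN (star x * x) ≤ g (star x * x) := by
  obtain ⟨H, _, _, _, π, Λ, h⟩ :=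
    exists_isGNSRepresentation (isNonneg_form_of_norm_sq_le hC0 hC) (hM.form_leftMul f)
  obtain ⟨ζ, hζ⟩ := exists_inner_eq_of_norm_sq_le h hC
  refine ⟨vectorFunctional π ζ, ⟨isRepresentable_vectorFunctional π ζ, fun a => ?_⟩, ?_⟩
  · rw [vectorFunctional_apply, map_apply_eq h hζ, hζ]
  · rintro g ⟨⟨-, K, _, _, _, σ, ξ, hσ⟩, hgf⟩ x
    simp only [ContinuousLinearMap.coe_coe] at hσ
    rw [vectorFunctional_apply, hσ, inner_map_star_mul_self, inner_map_star_mul_self]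
    refine Complex.real_le_real.mpr (pow_le_pow_left₀ (norm_nonneg _) ?_ 2)
    exact norm_map_apply_le h hζ (fun a => by rw [← hσ, hgf]) x

end IsLeftIdeal

end LeftIdeal

theorem theorem5p5 {A : Type u} [NonUnitalNormedRing A] [NormedSpace ℂ A]
    [IsScalarTower ℂ A A] [SMulCommClass ℂ A A] [CompleteSpace A] [StarRing A] [StarModule ℂ A]
    (M : Submodule ℂ A) (hM : IsLeftIdeal M) (f : M →ₗ[ℂ] ℂ) :
    List.TFAE [
      ∃ fN : A →L[ℂ] ℂ, IsRepresentableExtension f fN ∧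
        ∀ g : A →L[ℂ] ℂ, IsRepresentableExtension f g →
          ∀ x : A, fN (star x * x) ≤ g (star x * x),
      ∃ g : A →L[ℂ] ℂ, IsRepresentableExtension f g,
      ∃ C : ℝ, 0 ≤ C ∧ ∀ a : M,
        ((‖f a‖ ^ 2 : ℝ) : ℂ) ≤ (C : ℂ) * f ⟨star (a : A) * a, hM _ _ a.2⟩] := by
  tfae_have 1 → 2 := fun ⟨fN, hfN, _⟩ => ⟨fN, hfN⟩
  tfae_have 2 → 3 := fun ⟨_, hg⟩ => hg.exists_bound hM
  tfae_have 3 → 1 := fun ⟨_, hC0, hC⟩ => hM.exists_minimal_isRepresentableExtension hC0 hC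
  tfae_finish
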